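/- Let $d\ge 0$ and $m\ge 1$ be integers, $N=2^m-1$, $\lambda>0$, and let $\rho=1+\sqrt2$ be the silver ratio. The silver schedule $\pi^{(m)}=(\pi^{(m)}_0,\dots,\pi^{(m)}_{N-1})$ is defined by $\pi^{(1)}=[\sqrt2]$ and $\pi^{(k+1)}=[\pi^{(k)},\,1+\rho^{k-1},\,\pi^{(k)}]$ for $k\ge1$. For a proper, closed, convex function $f:\mathbb{R}^d\to\mathbb{R}\cup\{\infty\}$ that has a minimizer, let $$\mathrm{Prox}_{\lambda f}(x)=\arg\min_{u}\Big\{f(u)+\tfrac1{2\lambda}\|u-x\|^2\Big\},\qquad f^\lambda(x)=\min_u\Big\{f(u)+\tfrac1{2\lambda}\|u-x\|^2\Big\}.$$ The relaxed proximal point algorithm (RPPA) with schedule $\pi^{(m)}$ and starting point $x^0\in\mathbb{R}^d$ is $$z^k=\mathrm{Prox}_{\lambda f}(x^k)\ (0\le k\le N),\qquad x^{k+1}=x^k+\pi^{(m)}_k(z^k-x^k)\ (0\le k<N).$$ **Theorem.** (a) For every such $f$, every minimizer $x^\star$ of $f$ and every $x^0\in\mathbb{R}^d$: the minimum defining $f^\lambda(x)$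 is finite and attained at exactly one point for every $x$, $f^\lambda$ is differentiable on $\mathbb{R}^d$, and $$f(z^N)+\frac{\lambda}{2}\|\nabla f^\lambda(x^N)\|^2-f(x^\star)\le\frac{\|x^0-x^\star\|^2}{(4\rho^m-2)\lambda},\qquad \|\nabla f^\lambda(x^N)\|\le\frac{\|x^0-x^\star\|}{\rho^m\lambda}.$$ (b) The second bound is tight: for all $x^0,x^\star\in\mathbb{R}^d$ there is a proper, closed, convex $f$ with minimizer $x^\star$ such that RPPA started at $x^0$ satisfies $\|\nabla f^\lambda(x^N)\|=\|x^0-x^\star\|/(\rho^m\lambda)$. (c) $\rho^m=(N+1)^{\log_2\rho}$, where $\log_2\rho\approx1.2716$ (that is, $|\log_2\rho-1.2716|<5\cdot10^{-5}$), and consequently, in the situation of (a), there is an $O(1/N^{\log_2\rho})$ rate: $$f(z^N)+\frac{\lambda}{2}\|\nabla f^\lambda(x^N)\|^2-f(x^\star)\le\frac{\|x^0-x^\star\|^2}{2\lambda N^{\log_2\rho}},\qquad \|\nabla f^\lambda(x^N)\|\le\frac{\|x^0-x^\star\|}{\lambda N^{\log_2\rho}}.$$ -/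

import Mathlib

noncomputable section

/-- `ℝ^d` with the Euclidean norm. -/
abbrev Euc (d : ℕ) : Type := EuclideanSpace ℝ (Fin d)

/-- Proper, closed (lower semicontinuous) and convex extended-real-valued functions.
Convexity is convexity of the epigraph. -/
structure ProperClosedConvex {d : ℕ} (f : Euc d → EReal) : Prop where
  ne_bot : ∀ x, f x ≠ ⊥
  exists_ne_top : ∃ x, f x ≠ ⊤
  lsc : LowerSemicontinuous f
  convex_epigraph : Convex ℝ {p : Euc d × ℝ | f p.1 ≤ (p.2 : EReal)}

/-- The set of global minimizers of `f`. -/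
def minimizers {d : ℕ} (f : Euc d → EReal) : Set (Euc d) :=
  {x | ∀ y, f x ≤ f y}

/-- The function `u ↦ f u + (1 / (2 lam)) * ‖u - x‖ ^ 2`. -/
def proxObjective {d : ℕ} (f : Euc d → EReal) (lam : ℝ) (x u : Euc d) : EReal :=
  f u + ((1 / (2 * lam) * ‖u - x‖ ^ 2 : ℝ) : EReal)

/-- The proximal mapping: a minimizer of the proximal objective (an arbitrary point if there
is none). -/
def prox {d : ℕ} (f : Euc d → EReal) (lam : ℝ) (x : Euc d) : Euc d :=
  Classical.epsilon fun z => z ∈ minimizers (proxObjective f lam x)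

/-- The Moreau envelope, as a real-valued function. -/
def moreauEnvelope {d : ℕ} (f : Euc d → EReal) (lam : ℝ) (x : Euc d) : ℝ :=
  (⨅ u, proxObjective f lam x u).toReal

/-- The iterates `x^k` of the relaxed proximal point algorithm with relaxation parameters
`α k`. -/
def rppaX {d : ℕ} (f : Euc d → EReal) (lam : ℝ) (α : ℕ → ℝ) (x0 : Euc d) : ℕ → Euc d
  | 0 => x0
  | k + 1 => rppaX f lam α x0 k +
      α k • (prox f lam (rppaX f lam α x0 k) - rppaX f lam α x0 k)

/-- The proximal points `z^k` of the relaxed proximal point algorithm. -/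
def rppaZ {d : ℕ} (f : Euc d → EReal) (lam : ℝ) (α : ℕ → ℝ) (x0 : Euc d) (k : ℕ) : Euc d :=
  prox f lam (rppaX f lam α x0 k)

/-- The silver ratio. -/
def silverRatio : ℝ := 1 + √2

/-- The silver schedule `π^(m)` for `m ≥ 1`, as a list (empty for `m = 0`). -/
def silverList : ℕ → List ℝ
  | 0 => []
  | 1 => [√2]
  | m + 2 => silverList (m + 1) ++ [1 + silverRatio ^ m] ++ silverList (m + 1)

theorem length_silverList (m : ℕ) : (silverList m).length = 2 ^ m - 1 := by
  induction m using silverList.induct with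
  | case1 => simp [silverList]
  | case2 => simp [silverList]
  | case3 m ih =>
    have h : 1 ≤ 2 ^ m := Nat.one_le_two_pow
    simp only [silverList, List.length_append, ih, List.length_singleton, pow_succ]
    omega

/-- The entries of the silver schedule; only the indices `i < 2 ^ m - 1` matter. -/
def silverSchedule (m i : ℕ) : ℝ := (silverList m).getD i 0

end

/-! Put `F = lam * moreauEnvelope f lam` and `G x = x - prox f lam x`. Optimality of the proximal
points makes `(F, G)` satisfy the interpolation inequality of a smooth convex function and its
1-Lipschitz gradient (`ProperClosedConvex.interpolable`), and RPPA is gradient descent along `G`. So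
it suffices to bound gradient descent with silver steps.

The bound is proved by recursive gluing. A `Certificate` of rate `r` holds for every reference point
`y` and keeps the minorants at `y` unestimated, so certificates of consecutive blocks can be added.
`Certificate.glue` joins two copies of a schedule of rate `ρ * t` by a middle step `1 + t` into one
of rate `ρ * (ρ * t)`, using `ρ ^ 2 = 2 * ρ + 1`; induction gives rate `ρ ^ m`. Taking `y` to be a
minimizer, where `G y = 0`, then yields both bounds.

The gradient bound is attained by a multiple of `‖u - xs‖`: its envelope has constant gradient along
the whole trajectory. -/

/-- Final iterate of gradient descent with gradient map `G`, started at `x`, along a list of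
step sizes. -/
def descentEnd {E : Type*} [AddCommGroup E] [Module ℝ E] (G : E → E) : List ℝ → E → E
  | [], x => x
  | a :: l, x => descentEnd G l (x - a • G x)

theorem descentEnd_append {E : Type*} [AddCommGroup E] [Module ℝ E] (G : E → E)
    (l l' : List ℝ) (x : E) :
    descentEnd G (l ++ l') x = descentEnd G l' (descentEnd G l x) := by
  induction l generalizing x with
  | nil => rfl
  | cons a l ih => exact ih _

/-! ### Composable certificates for gradient descent -/

section Descent

variable {E : Type*} [NormedAddCommGroup E] [InnerProductSpace ℝ E]

/-- The interpolation inequality of convex functions `F` with 1-Lipschitz gradient `G`. -/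
def Interpolable (F : E → ℝ) (G : E → E) : Prop :=
  ∀ x y, F x + inner ℝ (G x) (y - x) + 1 / 2 * ‖G x - G y‖ ^ 2 ≤ F y

/-- The affine minorant at `x` that the interpolation inequality gives at critical points. -/
noncomputable def interpMinorant (F : E → ℝ) (G : E → E) (x y : E) : ℝ :=
  F x + inner ℝ (G x) (y - x) + 1 / 2 * ‖G x‖ ^ 2

/-- Sum of the minorants along the iterates, weighted by the step sizes. -/
noncomputable def minorantSum (F : E → ℝ) (G : E → E) (y : E) : List ℝ → E → ℝ
  | [], _ => 0
  | a :: l, x => a * interpMinorant F G x y + minorantSum F G y l (x - a • G x)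

theorem minorantSum_append (F : E → ℝ) (G : E → E) (y : E) (l l' : List ℝ) (x : E) :
    minorantSum F G y (l ++ l') x
      = minorantSum F G y l x + minorantSum F G y l' (descentEnd G l x) := by
  induction l generalizing x with
  | nil => simp [minorantSum, descentEnd]
  | cons a l ih => simp [minorantSum, descentEnd, ih, add_assoc]

variable {F : E → ℝ} {G : E → E}

theorem Interpolable.minorant_le (h : Interpolable F G) (x y : E) :
    interpMinorant F G x y ≤ F y - 1 / 2 * ‖G y‖ ^ 2 + inner ℝ (G y) (G x) := by
  have h1 := h x y
  rw [norm_sub_sq_real, real_inner_comm (G y) (G x)] at h1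
  unfold interpMinorant
  rw [real_inner_comm (G x) (G y)]
  linarith [real_inner_comm (G x) (G y)]

/-- The step-weighted gradients of the iterates telescope to the total displacement. -/
theorem Interpolable.minorantSum_le (h : Interpolable F G) (y : E) (l : List ℝ)
    (hl : ∀ a ∈ l, 0 ≤ a) (x : E) :
    minorantSum F G y l x ≤ l.sum * (F y - 1 / 2 * ‖G y‖ ^ 2)
      + inner ℝ (G y) (x - descentEnd G l x) := by
  induction l generalizing x with
  | nil => simp [minorantSum, descentEnd]
  | cons a l ih =>
    have h1 := ih (fun b hb => hl b (List.mem_cons_of_mem _ hb)) (x - a • G x)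
    have h2 := mul_le_mul_of_nonneg_left (h.minorant_le x y) (hl a List.mem_cons_self)
    simp only [minorantSum, descentEnd, List.sum_cons, inner_sub_right, inner_smul_right]
      at h1 h2 ⊢
    linarith

/-- The composable convergence certificate of a step size list with rate `1 / r`. -/
def Certificate (F : E → ℝ) (G : E → E) (l : List ℝ) (r : ℝ) : Prop :=
  ∀ x y, r * F (descentEnd G l x) + (r ^ 2 - r) * (1 / 2 * ‖G (descentEnd G l x)‖ ^ 2)
      + 1 / 2 * ‖descentEnd G l x - G (descentEnd G l x) - y‖ ^ 2
    ≤ 1 / 2 * ‖x - y‖ ^ 2 + minorantSum F G y l x + interpMinorant F G (descentEnd G l x) y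

theorem certificate_nil (F : E → ℝ) (G : E → E) : Certificate F G [] 1 := by
  intro x y
  simp only [descentEnd, minorantSum, interpMinorant, ← real_inner_self_eq_norm_sq,
    inner_sub_left, inner_sub_right, real_inner_comm x y, real_inner_comm (G x) x,
    real_inner_comm (G x) y]
  linarith

/-- The certificate with its minorants bounded by the interpolation inequalities at `y`. -/
theorem Certificate.le_of_interpolable (h : Interpolable F G) {l : List ℝ}
    (hl : ∀ a ∈ l, 0 ≤ a) {r : ℝ} (hr : l.sum = r - 1) (hc : Certificate F G l r) (x y : E) :
    r * F (descentEnd G l x) + (r ^ 2 - r) * (1 / 2 * ‖G (descentEnd G l x)‖ ^ 2)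
      + 1 / 2 * ‖descentEnd G l x - G (descentEnd G l x) - y‖ ^ 2
    ≤ 1 / 2 * ‖x - y‖ ^ 2 + r * (F y - 1 / 2 * ‖G y‖ ^ 2)
      + inner ℝ (G y) (x - descentEnd G l x + G (descentEnd G l x)) := by
  have h1 := hc x y
  have h2 := h.minorantSum_le y l hl x
  have h3 := h.minorant_le (descentEnd G l x) y
  rw [hr] at h2
  rw [inner_add_right]
  linarith

/-- Add the certificates of both halves at the same `y`. As `n - (1 + t) • G n - y = (n - G n - y) -
t • G n`, the cross term of the square is absorbed by the `t` extra copies of the minorant at `n`.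
What remains no longer involves `y`; it follows from the second half's certificate at the references
`n` and `p` and the interpolation inequality between these points. -/
theorem Certificate.glue (h : Interpolable F G) {l : List ℝ} (hl : ∀ a ∈ l, 0 ≤ a)
    {ρ t : ℝ} (hρ : ρ ^ 2 = 2 * ρ + 1) (hρ0 : 0 ≤ ρ) (ht : 0 ≤ t) (hs : l.sum = ρ * t - 1)
    (hc : Certificate F G l (ρ * t)) :
    Certificate F G (l ++ [1 + t] ++ l) (ρ * (ρ * t)) := by
  intro x y
  simp only [descentEnd_append, minorantSum_append, descentEnd, minorantSum]
  have P1 := hc x y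
  set n := descentEnd G l x with hn
  have P2 := hc (n - (1 + t) • G n) y
  have Tn := hc.le_of_interpolable h hl hs (n - (1 + t) • G n) n
  have Tp := hc.le_of_interpolable h hl hs (n - (1 + t) • G n)
    (descentEnd G l (n - (1 + t) • G n))
  set p := descentEnd G l (n - (1 + t) • G n) with hp
  have Q := h n p
  simp only [interpMinorant] at P1 P2 ⊢
  -- `u` is the difference of the gradient-step points `p - G p` and `n - G n`.
  obtain ⟨u, hu⟩ : ∃ u, p = u + n + G p - G n := ⟨p - G p - n + G n, by abel⟩
  generalize G n = a at *
  generalize G p = b at *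
  have Tn' : ρ * t * (F p - F n) + ((ρ * t) ^ 2 - ρ * t) * (1 / 2 * ‖b‖ ^ 2) + 1 / 2 * ‖u‖ ^ 2
      ≤ 1 / 2 * (t ^ 2 - ρ * t) * ‖a‖ ^ 2 := by
    have e1 : p - b - n = u - a := by rw [hu]; abel
    have e2 : n - (1 + t) • a - n = -((1 + t) • a) := by abel
    have e3 : n - (1 + t) • a - p + b = -(t • a) - u := by rw [hu, add_smul, one_smul]; abel
    rw [e1, e2, e3] at Tn
    simp only [← real_inner_self_eq_norm_sq, inner_sub_left, inner_sub_right, inner_smul_left,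
      inner_smul_right, inner_neg_left, inner_neg_right, real_inner_comm a u,
      RCLike.conj_to_real] at Tn ⊢
    linarith
  have Tp' : (ρ * t) ^ 2 * (1 / 2 * ‖b‖ ^ 2)
      ≤ 1 / 2 * (‖u‖ ^ 2 + 2 * t * inner ℝ a u + t ^ 2 * ‖a‖ ^ 2) := by
    have e1 : p - b - p = -b := by abel
    have e2 : n - (1 + t) • a - p = -(t • a) - u - b := by
      rw [hu, add_smul, one_smul]; abel
    have e3 : n - (1 + t) • a - p + b = -(t • a) - u := by rw [hu, add_smul, one_smul]; abel
    rw [e1, e3, e2] at Tp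
    simp only [← real_inner_self_eq_norm_sq, inner_sub_left, inner_sub_right, inner_smul_left,
      inner_smul_right, inner_neg_left, inner_neg_right, real_inner_comm a u,
      real_inner_comm a b, real_inner_comm u b, RCLike.conj_to_real] at Tp ⊢
    linarith
  have Q' : F n - F p ≤ - inner ℝ a u + 1 / 2 * ‖a‖ ^ 2 - 1 / 2 * ‖b‖ ^ 2 := by
    have e1 : p - n = u + b - a := by rw [hu]; abel
    rw [e1] at Q
    simp only [← real_inner_self_eq_norm_sq, inner_sub_left, inner_sub_right, inner_add_right,
      real_inner_comm a b] at Q ⊢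
    linarith
  have K : (ρ * (ρ * t) - ρ * t) * (F p - F n)
      + ((ρ * (ρ * t)) ^ 2 - ρ * (ρ * t) - (ρ * t) ^ 2 + ρ * t) * (1 / 2 * ‖b‖ ^ 2)
      ≤ ((ρ * t) ^ 2 - ρ * t - t ^ 2 - t) * (1 / 2 * ‖a‖ ^ 2) := by
    -- With weights `ρ`, `ρ` and `ρ * t` on `Tn'`, `Tp'` and `Q'`, the terms `‖u‖ ^ 2` and `inner ℝ
    -- a u` cancel.
    have k1 := mul_le_mul_of_nonneg_left (add_le_add Tn' Tp') hρ0
    have k2 := mul_le_mul_of_nonneg_left Q' (mul_nonneg hρ0 ht)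
    linear_combination k1 + k2 + (1 / 2 * ‖b‖ ^ 2 * (ρ * t) ^ 2
      + (1 / 2 * ‖a‖ ^ 2) * (- t ^ 2 - t)) * hρ
  have e4 : n - (1 + t) • a - y = (n - a - y) - t • a := by rw [add_smul, one_smul]; abel
  have e5 : y - n = - (n - a - y) - a := by abel
  rw [e4] at P2
  rw [e5, inner_sub_right, inner_neg_right, real_inner_self_eq_norm_sq] at P1 ⊢
  rw [norm_sub_sq_real (n - a - y) (t • a), inner_smul_right, norm_smul,
    Real.norm_eq_abs, mul_pow |t|, sq_abs, real_inner_comm a] at P2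
  linear_combination P1 + P2 + K + t * F n * hρ

/-- Gradient norm bound from the certificate. -/
theorem Certificate.norm_gradient_le (h : Interpolable F G) {l : List ℝ}
    (hl : ∀ a ∈ l, 0 ≤ a) {r : ℝ} (hr : l.sum = r - 1) (hr0 : 1 ≤ r) (hc : Certificate F G l r)
    (x : E) {y : E} (hy : G y = 0) : r * ‖G (descentEnd G l x)‖ ≤ ‖x - y‖ := by
  have h1 := hc.le_of_interpolable h hl hr x y
  have h2 := h y (descentEnd G l x)
  simp only [hy, norm_zero, inner_zero_left, zero_sub, norm_neg] at h1 h2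
  have h3 := mul_le_mul_of_nonneg_left h2 (by linarith : 0 ≤ r)
  have h4 := sq_nonneg ‖descentEnd G l x - G (descentEnd G l x) - y‖
  refine abs_le_of_sq_le_sq' ?_ (norm_nonneg _) |>.2
  linear_combination 2 * h1 + 2 * h3 + h4

/-- Objective gap bound from the certificate. -/
theorem Certificate.value_sub_le (h : Interpolable F G) {l : List ℝ}
    (hl : ∀ a ∈ l, 0 ≤ a) {r : ℝ} (hr : l.sum = r - 1) (hr0 : 1 ≤ r) (hc : Certificate F G l r)
    (x : E) {y : E} (hy : G y = 0) :
    (4 * r - 2) * (F (descentEnd G l x) - F y) ≤ ‖x - y‖ ^ 2 := by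
  have h1 := hc.le_of_interpolable h hl hr x y
  have h2 := h (descentEnd G l x) y
  simp only [hy, norm_zero, inner_zero_left, sub_zero] at h1 h2
  set p := descentEnd G l x
  -- Weight `r - 1` raises the coefficient of the gap from `r` to `2 * r - 1`, and the remaining
  -- quadratic terms form exactly the square in `h4`.
  have h3 := mul_le_mul_of_nonneg_left h2 (by linarith : 0 ≤ r - 1)
  have e : y - p = - (p - G p - y) - G p := by abel
  rw [e, inner_sub_right, inner_neg_right, real_inner_self_eq_norm_sq] at h3
  have h4 := sq_nonneg ‖p - G p - y - (r - 1) • G p‖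
  rw [norm_sub_sq_real, inner_smul_right, norm_smul, Real.norm_eq_abs,
    mul_pow |r - 1|, sq_abs, real_inner_comm (G p)] at h4
  linear_combination 2 * h1 + 2 * h3 + h4
end Descent

/-! ### The silver schedule and its certificate -/

theorem silverRatio_sq : silverRatio ^ 2 = 2 * silverRatio + 1 := by
  have h : √2 ^ 2 = 2 := Real.sq_sqrt (by norm_num)
  unfold silverRatio
  linear_combination h

theorem one_le_silverRatio : 1 ≤ silverRatio := by
  unfold silverRatio
  linarith [Real.sqrt_nonneg 2]

theorem silverList_nonneg (m : ℕ) : ∀ a ∈ silverList m, 0 ≤ a := by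
  have h0 := one_le_silverRatio
  induction m using silverList.induct with
  | case1 => simp [silverList]
  | case2 => simp [silverList]
  | case3 m ih =>
    intro a ha
    simp only [silverList, List.mem_append, List.mem_singleton] at ha
    rcases ha with (ha | rfl) | ha
    · exact ih a ha
    · positivity
    · exact ih a ha

theorem sum_silverList (m : ℕ) : (silverList m).sum = silverRatio ^ m - 1 := by
  induction m using silverList.induct with
  | case1 => simp [silverList]
  | case2 => simp [silverList, silverRatio]
  | case3 m ih =>
    simp only [silverList, List.sum_append, ih, List.sum_singleton, Nat.succ_eq_add_one]
    linear_combination - silverRatio ^ m * silverRatio_sq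

theorem certificate_silverList {E : Type*} [NormedAddCommGroup E] [InnerProductSpace ℝ E]
    {F : E → ℝ} {G : E → E} (h : Interpolable F G) (m : ℕ) :
    Certificate F G (silverList m) (silverRatio ^ m) := by
  have h0 : 0 < silverRatio := by linarith [one_le_silverRatio]
  induction m using silverList.induct with
  | case1 => simpa [silverList] using certificate_nil F G
  | case2 =>
    have h1 : silverRatio * silverRatio⁻¹ = 1 := mul_inv_cancel₀ h0.ne'
    have h2 : 1 + silverRatio⁻¹ = √2 := by
      have h3 : silverRatio * (√2 - 1 - silverRatio⁻¹) = 0 := by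
        have h : √2 ^ 2 = 2 := Real.sq_sqrt (by norm_num)
        rw [mul_sub, h1, silverRatio]
        linear_combination h
      linarith [(mul_eq_zero.1 h3).resolve_left h0.ne']
    -- The one-step schedule is two empty ones glued with `t = ρ⁻¹`, since `1 + ρ⁻¹ = √2`.
    have := Certificate.glue h (l := []) (by simp) silverRatio_sq h0.le (inv_nonneg.2 h0.le)
      (by simp [h1]) (by rw [h1]; exact certificate_nil F G)
    simpa [silverList, h1, h2] using this
  | case3 m ih =>
    have := Certificate.glue h (silverList_nonneg (m + 1)) silverRatio_sq h0.le
      (pow_nonneg h0.le m) (by rw [sum_silverList]; ring) (by convert ih using 1; ring)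
    rwa [show silverRatio * (silverRatio * silverRatio ^ m) = silverRatio ^ (m + 2) by ring] at this

theorem rppaX_eq_descentEnd {d : ℕ} (f : Euc d → EReal) (lam : ℝ) (l : List ℝ) (α : ℕ → ℝ)
    (hα : ∀ i, α i = l.getD i 0) (x0 : Euc d) :
    rppaX f lam α x0 l.length = descentEnd (fun x => x - prox f lam x) l x0 := by
  induction l generalizing α x0 with
  | nil => rfl
  | cons a l ih =>
    -- `rppaX` unfolds at its last step and `descentEnd` at its first, so the first step is moved
    -- into the starting point.
    have hs : ∀ k, rppaX f lam α x0 (k + 1)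
        = rppaX f lam (fun i => α (i + 1)) (x0 - a • (x0 - prox f lam x0)) k := by
      intro k
      induction k with
      | zero =>
        have : α 0 = a := by simp [hα]
        simp only [rppaX, this, ← neg_sub x0 (prox f lam x0), smul_neg, sub_eq_add_neg]
      | succ k ihk => rw [rppaX, ihk, rppaX]
    rw [List.length_cons, hs, ih _ (fun i => by simp [hα]), descentEnd]

/-! ### The exponent of the rate -/

theorem silverRatio_pow_eq (m N : ℕ) (hN : N = 2 ^ m - 1) :
    silverRatio ^ m = ((N : ℝ) + 1) ^ Real.logb 2 silverRatio := by
  have h0 : 0 < silverRatio := by linarith [one_le_silverRatio]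
  have h1 : (N : ℝ) + 1 = 2 ^ m := by
    rw [hN, Nat.cast_sub Nat.one_le_two_pow]
    push_cast
    ring
  rw [h1, ← Real.rpow_natCast 2 m, ← Real.rpow_mul (by norm_num), mul_comm,
    Real.rpow_mul (by norm_num), Real.rpow_logb (by norm_num) (by norm_num) h0, Real.rpow_natCast]

set_option exponentiation.threshold 1000 in
theorem abs_logb_silverRatio_sub_lt : |Real.logb 2 silverRatio - 1.2716| < 0.00005 := by
  have h0 : 0 < silverRatio := by linarith [one_le_silverRatio]
  have l1 : (2.4142135 : ℝ) ≤ silverRatio := by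
    have : (1.4142135 : ℝ) ≤ √2 := Real.le_sqrt_of_sq_le (by norm_num)
    unfold silverRatio
    linarith
  have l2 : silverRatio ≤ 2.41422 := by
    have : √2 ≤ (1.41422 : ℝ) := Real.sqrt_le_iff.2 (by norm_num)
    unfold silverRatio
    linarith
  -- The true value 1.271553... barely exceeds the required 1.27155, hence the large denominator;
  -- the claim becomes `2 ^ 295 < 2.4142135 ^ 232`.
  have lower : (295 : ℝ) / 232 < Real.logb 2 silverRatio := by
    have : ((295 : ℕ) : ℝ) < Real.logb 2 (silverRatio ^ 232) := by
      rw [Real.lt_logb_iff_rpow_lt (by norm_num) (by positivity), Real.rpow_natCast]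
      exact lt_of_lt_of_le (by norm_num) (pow_le_pow_left₀ (by norm_num) l1 232)
    rw [Real.logb_pow] at this
    push_cast at this
    linarith
  have upper : Real.logb 2 silverRatio < (103 : ℝ) / 81 := by
    have : Real.logb 2 (silverRatio ^ 81) < ((103 : ℕ) : ℝ) := by
      rw [Real.logb_lt_iff_lt_rpow (by norm_num) (by positivity), Real.rpow_natCast]
      exact lt_of_le_of_lt (pow_le_pow_left₀ h0.le l2 81) (by norm_num)
    rw [Real.logb_pow] at this
    push_cast at this
    linarith
  rw [abs_lt]
  constructor <;> linarith

/-! ### Proximal points and the Moreau envelope -/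

section Moreau

variable {d : ℕ} {f : Euc d → EReal} {lam : ℝ}

theorem ProperClosedConvex.minimizer_ne_top (hf : ProperClosedConvex f) {xs : Euc d}
    (hxs : xs ∈ minimizers f) : f xs ≠ ⊤ := by
  obtain ⟨y, hy⟩ := hf.exists_ne_top
  exact ne_top_of_le_ne_top hy (hxs y)

theorem ProperClosedConvex.exists_coe_eq (hf : ProperClosedConvex f) {x : Euc d}
    (hx : f x ≠ ⊤) : ∃ a : ℝ, f x = a :=
  ⟨(f x).toReal, (EReal.coe_toReal hx (hf.ne_bot x)).symm⟩

theorem ProperClosedConvex.lowerSemicontinuous_proxObjective (hf : ProperClosedConvex f)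
    (lam : ℝ) (x : Euc d) : LowerSemicontinuous (proxObjective f lam x) := by
  refine hf.lsc.add' (Continuous.lowerSemicontinuous ?_) fun u => ?_
  · exact continuous_coe_real_ereal.comp (by fun_prop)
  · exact EReal.continuousAt_add (Or.inr (EReal.coe_ne_bot _)) (Or.inl (hf.ne_bot u))

/-- Outside the closed ball around `x` through `xs`, both terms of the objective are at least their
values at `xs`, so compactness of the ball suffices. -/
theorem ProperClosedConvex.exists_minimizer_proxObjective (hf : ProperClosedConvex f)
    (hlam : 0 < lam) {xs : Euc d} (hxs : xs ∈ minimizers f) (x : Euc d) :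
    ∃ z, z ∈ minimizers (proxObjective f lam x) := by
  have hmem : xs ∈ Metric.closedBall x ‖xs - x‖ := by simp [dist_eq_norm]
  obtain ⟨z, -, hz⟩ := LowerSemicontinuousOn.exists_isMinOn ⟨xs, hmem⟩
    (isCompact_closedBall x ‖xs - x‖)
    ((hf.lowerSemicontinuous_proxObjective lam x).lowerSemicontinuousOn _)
  rw [isMinOn_iff] at hz
  refine ⟨z, fun u => ?_⟩
  by_cases hu : u ∈ Metric.closedBall x ‖xs - x‖
  · exact hz u hu
  · refine (hz xs hmem).trans (add_le_add (hxs u) (EReal.coe_le_coe_iff.2 ?_))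
    rw [Metric.mem_closedBall, dist_eq_norm, not_le] at hu
    gcongr

theorem ProperClosedConvex.ne_top_of_mem_minimizers_proxObjective (hf : ProperClosedConvex f)
    {x z : Euc d} (hz : z ∈ minimizers (proxObjective f lam x)) : f z ≠ ⊤ := by
  intro h
  obtain ⟨y, hy⟩ := hf.exists_ne_top
  obtain ⟨a, ha⟩ := hf.exists_coe_eq hy
  have := hz y
  simp only [proxObjective, h, ha, EReal.top_add_coe, ← EReal.coe_add, top_le_iff] at this
  exact EReal.coe_ne_top _ this

/-- The variational inequality characterising proximal points. -/
theorem ProperClosedConvex.add_inner_le (hf : ProperClosedConvex f) (hlam : 0 < lam)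
    {x z u : Euc d} (hz : z ∈ minimizers (proxObjective f lam x)) {a b : ℝ} (ha : f z = a)
    (hb : f u = b) : lam * a + inner ℝ (x - z) (u - z) ≤ lam * b := by
  -- Compare `z` with the point `(1 - s) • z + s • u`, divide by `s`, and later let `s` tend to 0.
  have key : ∀ s : ℝ, 0 < s → s ≤ 1 →
      lam * a + inner ℝ (x - z) (u - z) ≤ lam * b + s * (1 / 2 * ‖u - z‖ ^ 2) := by
    intro s hs hs1
    have hc := hf.convex_epigraph (x := (z, a)) (y := (u, b)) ha.le hb.le
      (sub_nonneg.2 hs1) hs.le (by ring)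
    have hm := (hz ((1 - s) • z + s • u)).trans (add_le_add_left hc _)
    simp only [proxObjective, ha, smul_eq_mul, Prod.smul_mk, Prod.mk_add_mk] at hm
    rw [← EReal.coe_add, ← EReal.coe_add, EReal.coe_le_coe_iff] at hm
    have e : (1 - s) • z + s • u - x = s • (u - z) - (x - z) := by
      rw [sub_smul, smul_sub, one_smul]; abel
    rw [e, norm_sub_sq_real (s • (u - z)), norm_smul, Real.norm_eq_abs, mul_pow |s|, sq_abs,
      inner_smul_left, RCLike.conj_to_real, norm_sub_rev z x, real_inner_comm (x - z)] at hm
    have h1 : 1 / (2 * lam) * lam = 1 / 2 := by field_simp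
    have h2 : s * (lam * a + inner ℝ (x - z) (u - z))
        ≤ s * (lam * b + s * (1 / 2 * ‖u - z‖ ^ 2)) := by
      have h3 := mul_le_mul_of_nonneg_left hm hlam.le
      linear_combination h3 + (s ^ 2 * ‖u - z‖ ^ 2 - 2 * s * inner ℝ (x - z) (u - z)) * h1
    exact le_of_mul_le_mul_left h2 hs
  refine le_of_forall_pos_le_add fun ε hε => ?_
  set C := 1 / 2 * ‖u - z‖ ^ 2 with hC
  have hC0 : 0 ≤ C := by positivity
  refine (key (min 1 (ε / (C + 1))) (by positivity) (min_le_left _ _)).trans ?_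
  have : min 1 (ε / (C + 1)) * C ≤ ε / (C + 1) * (C + 1) :=
    mul_le_mul (min_le_right _ _) (by linarith) hC0 (by positivity)
  rw [div_mul_cancel₀ _ (by positivity)] at this
  linarith

theorem ProperClosedConvex.eq_of_mem_minimizers_proxObjective (hf : ProperClosedConvex f)
    (hlam : 0 < lam) {x z z' : Euc d} (hz : z ∈ minimizers (proxObjective f lam x))
    (hz' : z' ∈ minimizers (proxObjective f lam x)) : z = z' := by
  obtain ⟨a, ha⟩ := hf.exists_coe_eq (hf.ne_top_of_mem_minimizers_proxObjective hz)
  obtain ⟨b, hb⟩ := hf.exists_coe_eq (hf.ne_top_of_mem_minimizers_proxObjective hz')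
  have h1 := hf.add_inner_le hlam hz ha hb
  have h2 := hf.add_inner_le hlam hz' hb ha
  have h3 : inner ℝ (x - z) (z' - z) + inner ℝ (x - z') (z - z') = ‖z - z'‖ ^ 2 := by
    rw [← neg_sub z z', inner_neg_right, ← real_inner_self_eq_norm_sq,
      ← sub_eq_neg_add, ← inner_sub_left]
    congr 1
    abel
  have h4 : ‖z - z'‖ ^ 2 ≤ 0 := by linarith
  exact sub_eq_zero.1 (norm_eq_zero.1 (pow_eq_zero_iff two_ne_zero |>.1
    (le_antisymm h4 (sq_nonneg _))))

theorem ProperClosedConvex.existsUnique_minimizer (hf : ProperClosedConvex f)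
    (hlam : 0 < lam) {xs : Euc d} (hxs : xs ∈ minimizers f) (x : Euc d) :
    ∃! z, z ∈ minimizers (proxObjective f lam x) := by
  obtain ⟨z, hz⟩ := hf.exists_minimizer_proxObjective hlam hxs x
  exact ⟨z, hz, fun z' hz' => hf.eq_of_mem_minimizers_proxObjective hlam hz' hz⟩

theorem ProperClosedConvex.prox_mem (hf : ProperClosedConvex f)
    (hlam : 0 < lam) {xs : Euc d} (hxs : xs ∈ minimizers f) (x : Euc d) :
    prox f lam x ∈ minimizers (proxObjective f lam x) :=
  Classical.epsilon_spec (hf.exists_minimizer_proxObjective hlam hxs x)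

theorem iInf_eq_of_mem_minimizers {g : Euc d → EReal} {z : Euc d} (hz : z ∈ minimizers g) :
    ⨅ u, g u = g z :=
  le_antisymm (iInf_le _ _) (le_iInf hz)

theorem ProperClosedConvex.coe_moreauEnvelope (hf : ProperClosedConvex f)
    (hlam : 0 < lam) {xs : Euc d} (hxs : xs ∈ minimizers f) (x : Euc d) :
    (moreauEnvelope f lam x : EReal) = ⨅ u, proxObjective f lam x u := by
  have hz := hf.prox_mem hlam hxs x
  obtain ⟨a, ha⟩ := hf.exists_coe_eq (hf.ne_top_of_mem_minimizers_proxObjective hz)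
  rw [moreauEnvelope, iInf_eq_of_mem_minimizers hz, proxObjective, ha, ← EReal.coe_add,
    EReal.toReal_coe]

theorem ProperClosedConvex.moreauEnvelope_eq (hf : ProperClosedConvex f)
    (hlam : 0 < lam) {xs : Euc d} (hxs : xs ∈ minimizers f) (x : Euc d) {a : ℝ}
    (ha : f (prox f lam x) = a) :
    lam * moreauEnvelope f lam x = lam * a + 1 / 2 * ‖x - prox f lam x‖ ^ 2 := by
  rw [moreauEnvelope, iInf_eq_of_mem_minimizers (hf.prox_mem hlam hxs x), proxObjective, ha,
    ← EReal.coe_add, EReal.toReal_coe, norm_sub_rev]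
  field_simp

/-- This is the variational inequality at `x` tested at the proximal point of `y`, rewritten in
terms of the residuals. -/
theorem ProperClosedConvex.interpolable (hf : ProperClosedConvex f)
    (hlam : 0 < lam) {xs : Euc d} (hxs : xs ∈ minimizers f) :
    Interpolable (fun x => lam * moreauEnvelope f lam x) (fun x => x - prox f lam x) := by
  intro x y
  have hx := hf.prox_mem hlam hxs x
  have hy := hf.prox_mem hlam hxs y
  obtain ⟨a, ha⟩ := hf.exists_coe_eq (hf.ne_top_of_mem_minimizers_proxObjective hx)
  obtain ⟨b, hb⟩ := hf.exists_coe_eq (hf.ne_top_of_mem_minimizers_proxObjective hy)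
  have h := hf.add_inner_le hlam hx ha hb
  simp only [hf.moreauEnvelope_eq hlam hxs x ha, hf.moreauEnvelope_eq hlam hxs y hb]
  have e : prox f lam y - prox f lam x
      = (y - x) + ((x - prox f lam x) - (y - prox f lam y)) := by abel
  rw [e] at h
  generalize x - prox f lam x = p at *
  generalize y - prox f lam y = q at *
  rw [inner_add_right, inner_sub_right p p q, real_inner_self_eq_norm_sq] at h
  rw [norm_sub_sq_real]
  linarith

/-- The inequality in both directions puts the linearization error between 0 and `1 / 2 * ‖y - x‖ ^
2`. -/
theorem Interpolable.hasGradientAt {E : Type*} [NormedAddCommGroup E] [InnerProductSpace ℝ E]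
    [CompleteSpace E] {F : E → ℝ} {G : E → E} (h : Interpolable F G) (x : E) :
    HasGradientAt F (G x) x := by
  rw [hasGradientAt_iff_isLittleO]
  refine Asymptotics.IsBigO.trans_isLittleO (g := fun y => ‖y - x‖ ^ 2) ?_ ?_
  · refine Asymptotics.IsBigO.of_bound 1 (Filter.Eventually.of_forall fun y => ?_)
    have h1 := h x y
    have h2 := h y x
    have h3 := sq_nonneg ‖G x - G y‖
    have h4 := sq_nonneg ‖(y - x) - (G y - G x)‖
    rw [norm_sub_sq_real, norm_sub_rev (G y), inner_sub_right,
      real_inner_comm (G y), real_inner_comm (G x)] at h4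
    rw [← neg_sub y x, inner_neg_right, norm_sub_rev (G y)] at h2
    have h5 := sq_nonneg ‖y - x‖
    rw [Real.norm_eq_abs, Real.norm_eq_abs, abs_of_nonneg h5, abs_le]
    constructor <;> linarith
  · exact (Asymptotics.isLittleO_pow_sub_sub x one_lt_two).congr_left (by simp)

theorem ProperClosedConvex.hasGradientAt_moreauEnvelope (hf : ProperClosedConvex f)
    (hlam : 0 < lam) {xs : Euc d} (hxs : xs ∈ minimizers f) (x : Euc d) :
    HasGradientAt (moreauEnvelope f lam) (lam⁻¹ • (x - prox f lam x)) x := by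
  have h := ((hf.interpolable hlam hxs).hasGradientAt x).hasFDerivAt.const_mul lam⁻¹
  simp only [inv_mul_cancel_left₀ hlam.ne', ← map_smul] at h
  exact h

theorem ProperClosedConvex.prox_minimizer (hf : ProperClosedConvex f)
    (hlam : 0 < lam) {xs : Euc d} (hxs : xs ∈ minimizers f) : prox f lam xs = xs := by
  refine hf.eq_of_mem_minimizers_proxObjective hlam (hf.prox_mem hlam hxs xs) fun u => ?_
  refine add_le_add (hxs u) (EReal.coe_le_coe_iff.2 ?_)
  have : 0 ≤ 1 / (2 * lam) * ‖u - xs‖ ^ 2 := by positivity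
  simpa using this

/-- Upper bounds for the relaxed proximal point algorithm with silver schedule. -/
theorem ProperClosedConvex.rppa_le (hf : ProperClosedConvex f)
    (hlam : 0 < lam) {xs : Euc d} (hxs : xs ∈ minimizers f) (x0 : Euc d) (m : ℕ) :
    f (rppaZ f lam (silverSchedule m) x0 (2 ^ m - 1))
          + ((lam / 2 * ‖gradient (moreauEnvelope f lam)
              (rppaX f lam (silverSchedule m) x0 (2 ^ m - 1))‖ ^ 2 : ℝ) : EReal)
          - f xs
        ≤ ((‖x0 - xs‖ ^ 2 / ((4 * silverRatio ^ m - 2) * lam) : ℝ) : EReal) ∧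
      ‖gradient (moreauEnvelope f lam) (rppaX f lam (silverSchedule m) x0 (2 ^ m - 1))‖
        ≤ ‖x0 - xs‖ / (silverRatio ^ m * lam) := by
  have hI := hf.interpolable hlam hxs
  have hr : 1 ≤ silverRatio ^ m := one_le_pow₀ one_le_silverRatio
  have hX : rppaX f lam (silverSchedule m) x0 (2 ^ m - 1)
      = descentEnd (fun x => x - prox f lam x) (silverList m) x0 := by
    rw [← length_silverList]
    exact rppaX_eq_descentEnd f lam (silverList m) _ (fun _ => rfl) x0
  have hG : xs - prox f lam xs = 0 := by rw [hf.prox_minimizer hlam hxs, sub_self]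
  have hcert := certificate_silverList hI m
  have hgrad := hcert.norm_gradient_le hI (silverList_nonneg m) (sum_silverList m) hr x0 hG
  have hval := hcert.value_sub_le hI (silverList_nonneg m) (sum_silverList m) hr x0 hG
  rw [rppaZ, hX]
  generalize descentEnd (fun x => x - prox f lam x) (silverList m) x0 = p at *
  obtain ⟨a, ha⟩ := hf.exists_coe_eq
    (hf.ne_top_of_mem_minimizers_proxObjective (hf.prox_mem hlam hxs p))
  obtain ⟨c, hc⟩ := hf.exists_coe_eq (hf.minimizer_ne_top hxs)
  have hc' : f (prox f lam xs) = c := by rw [hf.prox_minimizer hlam hxs, hc]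
  rw [(hf.hasGradientAt_moreauEnvelope hlam hxs p).gradient, ha, hc, norm_smul, norm_inv,
    Real.norm_of_nonneg hlam.le, ← EReal.coe_add, ← EReal.coe_sub, EReal.coe_le_coe_iff]
  simp only [hf.moreauEnvelope_eq hlam hxs p ha, hf.moreauEnvelope_eq hlam hxs xs hc', hG,
    norm_zero] at hval
  constructor
  · rw [le_div_iff₀ (mul_pos (by linarith) hlam)]
    refine le_trans (le_of_eq ?_) hval
    field_simp
    ring
  · rw [le_div_iff₀ (by positivity)]
    refine le_trans (le_of_eq ?_) hgrad
    field_simp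

end Moreau

/-! ### Tightness of the gradient bound -/

section Tightness

theorem properClosedConvex_const_mul_norm_sub {d : ℕ} {c : ℝ} (hc : 0 ≤ c) (xs : Euc d) :
    ProperClosedConvex fun u : Euc d => ((c * ‖u - xs‖ : ℝ) : EReal) where
  ne_bot _ := EReal.coe_ne_bot _
  exists_ne_top := ⟨xs, EReal.coe_ne_top _⟩
  lsc := (continuous_coe_real_ereal.comp (by fun_prop)).lowerSemicontinuous
  convex_epigraph := by
    have h : ConvexOn ℝ Set.univ fun u : Euc d => c * ‖u - xs‖ := by
      have := ((convexOn_univ_norm (E := Euc d)).translate_left (-xs)).smul hc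
      simpa [Function.comp_def, sub_eq_add_neg, add_comm] using this
    simpa only [Set.mem_univ, true_and, EReal.coe_le_coe_iff] using h.convex_epigraph

theorem minimizer_const_mul_norm_sub {d : ℕ} {c : ℝ} (hc : 0 ≤ c) (xs : Euc d) :
    xs ∈ minimizers fun u : Euc d => ((c * ‖u - xs‖ : ℝ) : EReal) := by
  intro u
  simp only [EReal.coe_le_coe_iff, sub_self, norm_zero, mul_zero]
  positivity

/-- Soft thresholding: before reaching `xs`, the proximal map moves by the fixed vector `-η • w`.
Optimality follows from Cauchy–Schwarz and one square. -/
theorem prox_const_mul_norm_sub {d : ℕ} {lam η τ : ℝ} (hlam : 0 < lam) (hη : 0 ≤ η)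
    (hτ : η ≤ τ) (xs w : Euc d) :
    prox (fun u : Euc d => ((η * ‖w‖ / lam * ‖u - xs‖ : ℝ) : EReal)) lam (xs + τ • w)
      = xs + (τ - η) • w := by
  have hc : 0 ≤ η * ‖w‖ / lam := by positivity
  have hf := properClosedConvex_const_mul_norm_sub hc xs
  refine hf.eq_of_mem_minimizers_proxObjective hlam
    (hf.prox_mem hlam (minimizer_const_mul_norm_sub hc xs) _) fun u => ?_
  simp only [proxObjective]
  rw [← EReal.coe_add, ← EReal.coe_add, EReal.coe_le_coe_iff]
  obtain ⟨v, rfl⟩ : ∃ v, u = xs + v := ⟨u - xs, by abel⟩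
  have e1 : xs + (τ - η) • w - (xs + τ • w) = -(η • w) := by rw [sub_smul]; abel
  have e2 : xs + v - (xs + τ • w) = v - τ • w := by abel
  rw [e1, e2, add_sub_cancel_left, add_sub_cancel_left, norm_neg, norm_smul, norm_smul,
    Real.norm_of_nonneg hη, Real.norm_of_nonneg (sub_nonneg.2 hτ)]
  have h1 := mul_le_mul_of_nonneg_left (real_inner_le_norm v w) hη
  have h2 := sq_nonneg ‖v - (τ - η) • w‖
  rw [norm_sub_sq_real, inner_smul_right, norm_smul, Real.norm_eq_abs, mul_pow |τ - η|,
    sq_abs] at h2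
  rw [norm_sub_sq_real, inner_smul_right, norm_smul, Real.norm_eq_abs, mul_pow |τ|, sq_abs]
  have h3 : lam⁻¹ * (η * ‖w‖ * ((τ - η) * ‖w‖) + 1 / 2 * (η * ‖w‖) ^ 2)
      ≤ lam⁻¹ * (η * ‖w‖ * ‖v‖
        + 1 / 2 * (‖v‖ ^ 2 - 2 * (τ * inner ℝ v w) + τ ^ 2 * ‖w‖ ^ 2)) := by
    refine mul_le_mul_of_nonneg_left ?_ (inv_nonneg.2 hlam.le)
    linear_combination h1 + 1 / 2 * h2
  refine le_trans (le_of_eq ?_) (h3.trans (le_of_eq ?_)) <;> field_simp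

theorem descentEnd_ray {E : Type*} [AddCommGroup E] [Module ℝ E] {G : E → E} {xs w : E} {η : ℝ}
    (hη : 0 ≤ η) (hG : ∀ τ, η ≤ τ → G (xs + τ • w) = η • w) (l : List ℝ)
    (hl : ∀ a ∈ l, 0 ≤ a) (τ : ℝ) (hτ : η * (1 + l.sum) ≤ τ) :
    descentEnd G l (xs + τ • w) = xs + (τ - η * l.sum) • w := by
  induction l generalizing τ with
  | nil => simp [descentEnd]
  | cons a l ih =>
    have hl' : ∀ b ∈ l, 0 ≤ b := fun b hb => hl b (List.mem_cons_of_mem _ hb)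
    have h1 : 0 ≤ η * a := mul_nonneg hη (hl a List.mem_cons_self)
    have h2 : 0 ≤ η * l.sum := mul_nonneg hη (List.sum_nonneg hl')
    rw [List.sum_cons] at hτ ⊢
    have e : xs + τ • w - a • η • w = xs + (τ - η * a) • w := by module
    rw [descentEnd, hG τ (by linarith), e, ih hl' _ (by linarith)]
    congr 2
    ring

theorem rppa_gradient_tight {d : ℕ} {lam : ℝ} (hlam : 0 < lam) (m : ℕ) (x0 xs : Euc d) :
    ∃ f : Euc d → EReal, ProperClosedConvex f ∧ xs ∈ minimizers f ∧
      ‖gradient (moreauEnvelope f lam) (rppaX f lam (silverSchedule m) x0 (2 ^ m - 1))‖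
        = ‖x0 - xs‖ / (silverRatio ^ m * lam) := by
  have hr : 0 < silverRatio ^ m := by linarith [one_le_pow₀ one_le_silverRatio (n := m)]
  set η := (silverRatio ^ m)⁻¹ with hη_def
  have hη : 0 ≤ η := inv_nonneg.2 hr.le
  have hηr : η * silverRatio ^ m = 1 := inv_mul_cancel₀ hr.ne'
  set w := x0 - xs with hw
  have hc : 0 ≤ η * ‖w‖ / lam := by positivity
  set f : Euc d → EReal := fun u => ((η * ‖w‖ / lam * ‖u - xs‖ : ℝ) : EReal) with hf_def
  have hf : ProperClosedConvex f := properClosedConvex_const_mul_norm_sub hc xs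
  have hxs : xs ∈ minimizers f := minimizer_const_mul_norm_sub hc xs
  refine ⟨f, hf, hxs, ?_⟩
  have hG : ∀ τ, η ≤ τ → xs + τ • w - prox f lam (xs + τ • w) = η • w := by
    intro τ hτ
    rw [prox_const_mul_norm_sub hlam hη hτ]
    module
  have hX : rppaX f lam (silverSchedule m) x0 (2 ^ m - 1) = xs + η • w := by
    have h := rppaX_eq_descentEnd f lam (silverList m) (silverSchedule m) (fun _ => rfl) x0
    rw [length_silverList] at h
    have e : x0 = xs + (1 : ℝ) • w := by rw [hw, one_smul]; abel
    rw [h]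
    conv_lhs => rw [e]
    -- Since `η * (1 + sum) = 1`, the start `τ = 1` is exactly admissible and the last iterate has
    -- `τ = η`, the end of the range where `G` is constant.
    rw [descentEnd_ray hη hG _ (silverList_nonneg m) 1
      (by rw [sum_silverList]; linarith), sum_silverList]
    congr 2
    linarith
  rw [hX, (hf.hasGradientAt_moreauEnvelope hlam hxs _).gradient, hG η le_rfl, norm_smul,
    norm_smul, norm_inv, Real.norm_of_nonneg hlam.le, Real.norm_of_nonneg hη, hη_def]
  field_simp

end Tightness

/-! ### The main theorem -/

theorem mainTheorem2 (d m N : ℕ) (hm : 1 ≤ m) (hN : N = 2 ^ m - 1) (lam : ℝ) (hlam : 0 < lam) :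
    -- well-posedness and the two upper bounds, with the resulting rates in `N`
    (∀ f : Euc d → EReal, ProperClosedConvex f → ∀ xstar ∈ minimizers f, ∀ x0 : Euc d,
      (∀ x : Euc d, (∃! z, z ∈ minimizers (proxObjective f lam x)) ∧
        (moreauEnvelope f lam x : EReal) = ⨅ u, proxObjective f lam x u) ∧
      Differentiable ℝ (moreauEnvelope f lam) ∧
      f (rppaZ f lam (silverSchedule m) x0 N)
          + ((lam / 2 * ‖gradient (moreauEnvelope f lam)
              (rppaX f lam (silverSchedule m) x0 N)‖ ^ 2 : ℝ) : EReal)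
          - f xstar
        ≤ ((‖x0 - xstar‖ ^ 2 / ((4 * silverRatio ^ m - 2) * lam) : ℝ) : EReal) ∧
      ‖gradient (moreauEnvelope f lam) (rppaX f lam (silverSchedule m) x0 N)‖
        ≤ ‖x0 - xstar‖ / (silverRatio ^ m * lam) ∧
      f (rppaZ f lam (silverSchedule m) x0 N)
          + ((lam / 2 * ‖gradient (moreauEnvelope f lam)
              (rppaX f lam (silverSchedule m) x0 N)‖ ^ 2 : ℝ) : EReal)
          - f xstar
        ≤ ((‖x0 - xstar‖ ^ 2 / (2 * lam * (N : ℝ) ^ Real.logb 2 silverRatio) : ℝ) : EReal) ∧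
      ‖gradient (moreauEnvelope f lam) (rppaX f lam (silverSchedule m) x0 N)‖
        ≤ ‖x0 - xstar‖ / (lam * (N : ℝ) ^ Real.logb 2 silverRatio)) ∧
    -- tightness of the gradient bound
    (∀ x0 xstar : Euc d, ∃ f : Euc d → EReal, ProperClosedConvex f ∧ xstar ∈ minimizers f ∧
      ‖gradient (moreauEnvelope f lam) (rppaX f lam (silverSchedule m) x0 N)‖
        = ‖x0 - xstar‖ / (silverRatio ^ m * lam)) ∧
    -- the exponent of the rate
    silverRatio ^ m = ((N : ℝ) + 1) ^ Real.logb 2 silverRatio ∧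
    |Real.logb 2 silverRatio - 1.2716| < 0.00005 := by
  have hρN := silverRatio_pow_eq m N hN
  refine ⟨fun f hf xs hxs x0 => ?_, fun x0 xs => ?_, hρN, abs_logb_silverRatio_sub_lt⟩
  · obtain ⟨h1, h2⟩ := hf.rppa_le hlam hxs x0 m
    rw [← hN] at h1 h2
    have hN1 : 1 ≤ N := by
      have := Nat.pow_le_pow_right (n := 2) (by norm_num) hm
      omega
    have hN0 : (0 : ℝ) < N := by exact_mod_cast hN1
    have hpos : 0 < (N : ℝ) ^ Real.logb 2 silverRatio := Real.rpow_pos_of_pos hN0 _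
    have hle : (N : ℝ) ^ Real.logb 2 silverRatio ≤ silverRatio ^ m := by
      rw [hρN]
      exact Real.rpow_le_rpow hN0.le (by linarith)
        (Real.logb_nonneg (by norm_num) one_le_silverRatio)
    have hr : 1 ≤ silverRatio ^ m := one_le_pow₀ one_le_silverRatio
    refine ⟨fun x => ⟨hf.existsUnique_minimizer hlam hxs x, hf.coe_moreauEnvelope hlam hxs x⟩,
      fun x => (hf.hasGradientAt_moreauEnvelope hlam hxs x).differentiableAt, h1, h2,
      h1.trans (EReal.coe_le_coe_iff.2 ?_), h2.trans ?_⟩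
    · refine div_le_div_of_nonneg_left (sq_nonneg _) (by positivity) ?_
      -- As `ρ ^ m ≥ 1`, `4 * ρ ^ m - 2 ≥ 2 * ρ ^ m`.
      have := mul_le_mul_of_nonneg_right
        (show 2 * (N : ℝ) ^ Real.logb 2 silverRatio ≤ 4 * silverRatio ^ m - 2 by linarith) hlam.le
      linarith
    · refine div_le_div_of_nonneg_left (norm_nonneg _) (by positivity) ?_
      have := mul_le_mul_of_nonneg_right hle hlam.le
      linarith
  · rw [hN]
    exact rppa_gradient_tight hlam m x0 xs
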